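/- Let $p$ be an odd prime. For elements $x,y$ of a group write $[x,y]=x^{-1}y^{-1}xy$. Consider the following four groups of order $p^6$, each with generators $\alpha_1,\alpha_2,\alpha_3,\alpha_4,\beta$ and defining relations $$[\alpha_1,\alpha_2]=[\alpha_3,\alpha_4]=\beta,\qquad \text{all other pairs of generators commute},\qquad \beta^p=1,$$ together with, respectively: - $\Phi_5(3111)$: $\alpha_1^{p^2}=\beta$, $\alpha_2^p=\alpha_3^p=\alpha_4^p=1$; - $\Phi_5(2211)a$: $\alpha_2^p=\beta$, $\alpha_1^{p^2}=\alpha_3^p=\alpha_4^p=1$; - $\Phi_5(2211)b$: $\alpha_3^p=\beta$, $\alpha_1^{p^2}=\alpha_2^p=\alpha_4^p=1$; - $\Phi_5(21^4)c$: $\alpha_1^{p^2}=\alpha_2^p=\alpha_3^p=\alpha_4^p=1$. For a group $G$ and a 2-cocycle $\alpha\in Z^2(G,\mathbb{C}^\times)$ (trivial action), let $\mathbb{C}^\alpha G$ be the twisted group algebra, i.e. the $\mathbb{C}$-algebra with basis $\{\bar g: g\in G\}$ and multiplication $\bar g\,\bar h=\alpha(g,h)\overline{gh}$. Write $G\sim_{\mathbb{C}}H$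 if there is a group isomorphism $\phi: \mathrm{H}^2(G,\mathbb{C}^\times)\to \mathrm{H}^2(H,\mathbb{C}^\times)$ such that, for all $\alpha\in Z^2(G,\mathbb{C}^\times)$ and $\beta\in Z^2(H,\mathbb{C}^\times)$ with $[\beta]=\phi([\alpha])$, $\mathbb{C}^\alpha G\cong\mathbb{C}^{\beta}H$ as $\mathbb{C}$-algebras. If each of the groups $G$ and $H$ is isomorphic to one of $\Phi_5(3111)$, $\Phi_5(2211)a$, $\Phi_5(2211)b$, $\Phi_5(21^4)c$ (for the same $p$), then $G\sim_{\mathbb{C}}H$. -/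

import Mathlib

noncomputable section

/-! ### Second cohomology with trivial coefficients `Rˣ` -/

/-- The unit group `Rˣ`, written additively, as a `G`-module with trivial action. -/
abbrev unitsRep (R G : Type) [CommRing R] [Group G] : Rep ℤ G :=
  Rep.trivial ℤ G (Additive Rˣ)

/-- `Z²(G, Rˣ)` for the trivial action of `G` on `Rˣ`. -/
abbrev TwoCocycle (R G : Type) [CommRing R] [Group G] : Type :=
  groupCohomology.cocycles₂ (unitsRep R G)

/-- `H²(G, Rˣ)` for the trivial action of `G` on `Rˣ` (an additively written abelian group). -/
abbrev SecondCohomology (R G : Type) [CommRing R] [Group G] : Type :=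
  groupCohomology.H2 (unitsRep R G)

namespace TwoCocycle

variable {R G : Type} [CommRing R] [Group G]

/-- The value `α(g, h)` as a unit of `R`. -/
def unit (α : TwoCocycle R G) (g h : G) : Rˣ := Additive.toMul (α (g, h))

/-- The cohomology class `[α]`. -/
def cls (α : TwoCocycle R G) : SecondCohomology R G :=
  groupCohomology.H2π (unitsRep R G) α

/-- The cocycle identity `α(g, h) α(gh, j) = α(h, j) α(g, hj)`. -/
theorem unit_mul_unit (α : TwoCocycle R G) (g h j : G) :
    α.unit g h * α.unit (g * h) j = α.unit h j * α.unit g (h * j) := by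
  have := (groupCohomology.mem_cocycles₂_iff (α : G × G → unitsRep R G)).1 α.2 g h j
  rw [Rep.trivial_ρ_apply] at this
  rw [mul_comm]
  exact congrArg Additive.toMul this

theorem unit_one_left (α : TwoCocycle R G) (g : G) : α.unit 1 g = α.unit 1 1 :=
  congrArg Additive.toMul (groupCohomology.cocycles₂_map_one_fst α g)

theorem unit_one_right (α : TwoCocycle R G) (g : G) : α.unit g 1 = α.unit 1 1 :=
  congrArg Additive.toMul (groupCohomology.cocycles₂_map_one_snd α g)

end TwoCocycle

/-! ### Twisted group algebras -/

/-- The twisted group algebra `R^α G`: the free `R`-module with basis `ḡ`, `g ∈ G`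
(here `ḡ` is `basisElt α g`), with the `R`-bilinear multiplication
determined by `ḡ h̄ = α(g, h) \overline{gh}`. -/
def TwistedGroupAlgebra {R G : Type} [CommRing R] [Group G] (_α : TwoCocycle R G) : Type :=
  G →₀ R

namespace TwistedGroupAlgebra

variable {R G : Type} [CommRing R] [Group G] (α : TwoCocycle R G)

instance : AddCommGroup (TwistedGroupAlgebra α) := inferInstanceAs (AddCommGroup (G →₀ R))

instance : Module R (TwistedGroupAlgebra α) := inferInstanceAs (Module R (G →₀ R))

/-- The basis element `ḡ`. -/
def basisElt (g : G) : TwistedGroupAlgebra α := Finsupp.single g (1 : R)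

/-- The `ḡ` form an `R`-basis. -/
def basis : Module.Basis G R (TwistedGroupAlgebra α) :=
  Module.Basis.ofRepr (LinearEquiv.refl R (G →₀ R))

theorem basis_apply (g : G) : basis α g = basisElt α g := rfl

/-- The multiplication as an `R`-bilinear map. -/
def mulHom : TwistedGroupAlgebra α →ₗ[R] TwistedGroupAlgebra α →ₗ[R] TwistedGroupAlgebra α :=
  (basis α).constr R fun g => (basis α).constr R fun h =>
    (α.unit g h : R) • basisElt α (g * h)

theorem mulHom_basis (g h : G) :
    mulHom α (basisElt α g) (basisElt α h) = (α.unit g h : R) • basisElt α (g * h) := by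
  simp only [mulHom, ← basis_apply, Module.Basis.constr_basis]

instance : Mul (TwistedGroupAlgebra α) := ⟨fun x y => mulHom α x y⟩

/-- The identity element is `α(1, 1)⁻¹ 1̄`. -/
instance : One (TwistedGroupAlgebra α) :=
  ⟨(((α.unit 1 1)⁻¹ : Rˣ) : R) • basisElt α 1⟩

theorem mul_def (x y : TwistedGroupAlgebra α) : x * y = mulHom α x y := rfl

theorem one_def :
    (1 : TwistedGroupAlgebra α) = (((α.unit 1 1)⁻¹ : Rˣ) : R) • basisElt α 1 := rfl

theorem basisElt_mul_basisElt (g h : G) :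
    basisElt α g * basisElt α h = (α.unit g h : R) • basisElt α (g * h) := mulHom_basis α g h

protected theorem one_mul' (x : TwistedGroupAlgebra α) : 1 * x = x := by
  have : mulHom α 1 = LinearMap.id := by
    refine (basis α).ext fun g => ?_
    rw [basis_apply, one_def, map_smul, LinearMap.smul_apply, mulHom_basis, one_mul,
      α.unit_one_left g, smul_smul, Units.inv_mul, one_smul, LinearMap.id_apply]
  exact LinearMap.congr_fun this x

protected theorem mul_one' (x : TwistedGroupAlgebra α) : x * 1 = x := by
  have : (mulHom α).flip 1 = LinearMap.id := by
    refine (basis α).ext fun g => ?_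
    rw [basis_apply, LinearMap.flip_apply, one_def, map_smul, mulHom_basis, mul_one,
      α.unit_one_right g, smul_smul, Units.inv_mul, one_smul, LinearMap.id_apply]
  exact LinearMap.congr_fun this x

protected theorem mul_assoc' (x y z : TwistedGroupAlgebra α) : x * y * z = x * (y * z) := by
  have h1 (g h : G) (z : TwistedGroupAlgebra α) :
      mulHom α (mulHom α (basisElt α g) (basisElt α h)) z =
        mulHom α (basisElt α g) (mulHom α (basisElt α h) z) := by
    have : mulHom α (mulHom α (basisElt α g) (basisElt α h)) =
        mulHom α (basisElt α g) ∘ₗ mulHom α (basisElt α h) := by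
      refine (basis α).ext fun j => ?_
      rw [basis_apply, LinearMap.comp_apply, mulHom_basis, mulHom_basis, map_smul, map_smul,
        LinearMap.smul_apply, mulHom_basis, mulHom_basis, smul_smul, smul_smul, mul_assoc g h j]
      congr 1
      exact_mod_cast congrArg Units.val (α.unit_mul_unit g h j)
    exact LinearMap.congr_fun this z
  have h2 (g : G) (y z : TwistedGroupAlgebra α) :
      mulHom α (mulHom α (basisElt α g) y) z = mulHom α (basisElt α g) (mulHom α y z) := by
    have : (mulHom α).flip z ∘ₗ mulHom α (basisElt α g) =
        mulHom α (basisElt α g) ∘ₗ (mulHom α).flip z :=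
      (basis α).ext fun h => h1 g h z
    exact LinearMap.congr_fun this y
  have h3 : (mulHom α).flip z ∘ₗ (mulHom α).flip y = (mulHom α).flip (mulHom α y z) :=
    (basis α).ext fun g => h2 g y z
  exact LinearMap.congr_fun h3 x

instance : Ring (TwistedGroupAlgebra α) :=
  { (inferInstance : AddCommGroup (TwistedGroupAlgebra α)) with
    mul := (· * ·)
    one := 1
    left_distrib := fun x y z => map_add (mulHom α x) y z
    right_distrib := fun x y z => LinearMap.map_add₂ (mulHom α) x y z
    zero_mul := fun x => LinearMap.map_zero₂ (mulHom α) x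
    mul_zero := fun x => map_zero (mulHom α x)
    mul_assoc := TwistedGroupAlgebra.mul_assoc' α
    one_mul := TwistedGroupAlgebra.one_mul' α
    mul_one := TwistedGroupAlgebra.mul_one' α }

instance : Algebra R (TwistedGroupAlgebra α) :=
  Algebra.ofModule (fun r x y => LinearMap.map_smul₂ (mulHom α) r x y)
    (fun r x y => map_smul (mulHom α x) r y)

end TwistedGroupAlgebra

/-- The relation `G ∼_R H`: there is an isomorphism of groups `φ : H²(G, Rˣ) ≃ H²(H, Rˣ)`
such that `R^α G ≅ R^β H` as `R`-algebras whenever `[β] = φ [α]`. -/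
def TwistedEquiv (R G H : Type) [CommRing R] [Group G] [Group H] : Prop :=
  ∃ φ : SecondCohomology R G ≃+ SecondCohomology R H,
    ∀ (α : TwoCocycle R G) (β : TwoCocycle R H), φ α.cls = β.cls →
      Nonempty (TwistedGroupAlgebra α ≃ₐ[R] TwistedGroupAlgebra β)

/-! ### Four groups of order `p⁶` in the isoclinism class `Φ₅` -/

/-- The names of the groups `Φ₅(3111)`, `Φ₅(2211)a`, `Φ₅(2211)b`, `Φ₅(21⁴)c`. -/
inductive PhiFiveName : Type
  | phi3111
  | phi2211a
  | phi2211b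
  | phi21111c

namespace PhiFive

/-- The generators `α₁, α₂, α₃, α₄, β`. -/
inductive Gen : Type
  | a1
  | a2
  | a3
  | a4
  | b

/-- The free group on the generators. -/
abbrev F : Type := FreeGroup Gen

def α₁ : F := FreeGroup.of Gen.a1
def α₂ : F := FreeGroup.of Gen.a2
def α₃ : F := FreeGroup.of Gen.a3
def α₄ : F := FreeGroup.of Gen.a4
def β : F := FreeGroup.of Gen.b

/-- The commutator `[x, y] = x⁻¹ y⁻¹ x y`. -/
def comm (x y : F) : F := x⁻¹ * y⁻¹ * x * y

/-- The commutator relators shared by the four groups: `[α₁, α₂] = [α₃, α₄] = β`, and all other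
pairs of generators commute. -/
def commRels : Set F :=
  {comm α₁ α₂ * β⁻¹, comm α₃ α₄ * β⁻¹,
    comm α₁ α₃, comm α₁ α₄, comm α₂ α₃, comm α₂ α₄,
    comm α₁ β, comm α₂ β, comm α₃ β, comm α₄ β}

/-- The power relators of the four groups. -/
def powRels (p : ℕ) : PhiFiveName → Set F
  | .phi3111 => {α₁ ^ p ^ 2 * β⁻¹, α₂ ^ p, α₃ ^ p, α₄ ^ p, β ^ p}
  | .phi2211a => {α₂ ^ p * β⁻¹, α₁ ^ p ^ 2, α₃ ^ p, α₄ ^ p, β ^ p}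
  | .phi2211b => {α₃ ^ p * β⁻¹, α₁ ^ p ^ 2, α₂ ^ p, α₄ ^ p, β ^ p}
  | .phi21111c => {α₁ ^ p ^ 2, α₂ ^ p, α₃ ^ p, α₄ ^ p, β ^ p}

end PhiFive

/-- The group `Φ₅(⋯)` of order `p⁶` with the given name, by generators `α₁, α₂, α₃, α₄, β` and
relations: `[α₁, α₂] = [α₃, α₄] = β`, all other pairs of generators commute, and
* `Φ₅(3111)`: `α₁^(p²) = β`, `α₂^p = α₃^p = α₄^p = β^p = 1`;
* `Φ₅(2211)a`: `α₂^p = β`, `α₁^(p²) = α₃^p = α₄^p = β^p = 1`;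
* `Φ₅(2211)b`: `α₃^p = β`, `α₁^(p²) = α₂^p = α₄^p = β^p = 1`;
* `Φ₅(21⁴)c`: `α₁^(p²) = α₂^p = α₃^p = α₄^p = β^p = 1`. -/
abbrev PhiFiveGroup (p : ℕ) (n : PhiFiveName) : Type :=
  PresentedGroup (PhiFive.commRels ∪ PhiFive.powRels p n)

end

/-! All four groups are central extensions of the same abelian group `Q` (isomorphic to `ℤ/p² ×
(ℤ/p)³`) by `⟨β⟩`, and neither the cohomology nor the twisted algebras can tell these extensions
apart over `ℂ`.

The element `β` is a commutator of two pairs of generators, and each pair commutes with the other.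
Hence the lift of `β` to any twisted group algebra is central (`commute_unitElt_of_comm`,
`unit_of_b_comm`), and every class on `G` is inflated from `Q` (`inflation_surjective`). The kernel
of inflation consists of the cocycles cohomologous to a multiple of `μ`, the image of the extension
class under the character `β ↦ ζ`, with `ζ` a primitive `p`-th root of unity
(`inflation_eq_zero_iff`). Splitting by the characters of `⟨β⟩` gives `ℂ^(inf l) G ≅ ∏ₖ ℂ^(l + kμ)
Q` (`algEquivPi`). Thus both `H²` and the algebras depend only on `Q` and `μ`.

It remains to see that one `μ` serves all four groups. They differ only in their power relations,
and these disappear in `ℂˣ`, which is divisible: in the Heisenberg extension of `(ℤ/p)⁴` by `ℂˣ` the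
lifts of the generators can be rescaled by roots of `ζ` to satisfy any of the four sets of relations
(`exists_powRelations_heisenbergGen`). The structure `CyclicCover` collects what the argument needs
from each group. -/

noncomputable section

/-! ### Cocycles, their classes and inflation -/

namespace TwoCocycle

variable {R G A : Type} [CommRing R] [Group G] [Group A]

/-- The cocycle with prescribed values. -/
def ofUnit (f : G → G → Rˣ)
    (hf : ∀ g h j, f g h * f (g * h) j = f h j * f g (h * j)) : TwoCocycle R G :=
  ⟨fun x => Additive.ofMul (f x.1 x.2), (groupCohomology.mem_cocycles₂_iff _).2 fun g h j => by
    refine congrArg Additive.ofMul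
      (?_ : f (g * h) j * f g h = f h j * f g (h * j))
    rw [mul_comm, hf]⟩

@[simp]
theorem unit_ofUnit (f : G → G → Rˣ) (hf) (g h : G) :
    (ofUnit f hf : TwoCocycle R G).unit g h = f g h := rfl

@[simp]
theorem unit_add (α α' : TwoCocycle R G) (g h : G) :
    (α + α').unit g h = α.unit g h * α'.unit g h := rfl

@[simp]
theorem unit_nsmul (k : ℕ) (α : TwoCocycle R G) (g h : G) :
    (k • α).unit g h = α.unit g h ^ k := by
  induction k with
  | zero => simp only [zero_smul, pow_zero]; rfl
  | succ k ih => rw [succ_nsmul, unit_add, ih, pow_succ]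

/-- Pulling back a cocycle along a group homomorphism. -/
def pull (π : G →* A) : TwoCocycle R A →+ TwoCocycle R G where
  toFun α := ofUnit (fun g h => α.unit (π g) (π h)) fun g h j => by
    simpa only [map_mul] using α.unit_mul_unit (π g) (π h) (π j)
  map_zero' := rfl
  map_add' _ _ := rfl

@[simp]
theorem unit_pull (π : G →* A) (α : TwoCocycle R A) (g h : G) :
    (pull π α).unit g h = α.unit (π g) (π h) := rfl

theorem cls_surjective : Function.Surjective (cls : TwoCocycle R G → SecondCohomology R G) :=
  (ModuleCat.epi_iff_surjective (groupCohomology.H2π (unitsRep R G))).1 inferInstance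

theorem cls_add (α α' : TwoCocycle R G) : (α + α').cls = α.cls + α'.cls :=
  map_add (groupCohomology.H2π (unitsRep R G)).hom α α'

theorem cls_eq_zero_iff {α : TwoCocycle R G} :
    α.cls = 0 ↔ ∃ f : G → Rˣ, ∀ g h, α.unit g h * f (g * h) = f g * f h := by
  refine (groupCohomology.H2π_eq_zero_iff (A := unitsRep R G) α).trans ⟨?_, ?_⟩
  · rintro ⟨f, hf⟩
    refine ⟨fun g => Additive.toMul (f g), fun g h => ?_⟩
    have h2 : Additive.toMul (α := Rˣ) (f h) / Additive.toMul (α := Rˣ) (f (g * h)) *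
        Additive.toMul (α := Rˣ) (f g) = α.unit g h :=
      congrArg Additive.toMul (congrFun hf (g, h))
    rw [← h2, div_mul_eq_mul_div, div_mul_cancel, mul_comm]
  · rintro ⟨f, hf⟩
    refine ⟨fun g => Additive.ofMul (f g), funext fun ⟨g, h⟩ => ?_⟩
    refine congrArg Additive.ofMul (?_ : f h / f (g * h) * f g = α.unit g h)
    rw [div_mul_eq_mul_div, div_eq_iff_eq_mul, hf, mul_comm]

theorem cls_eq_iff {α α' : TwoCocycle R G} :
    α.cls = α'.cls ↔
      ∃ f : G → Rˣ, ∀ g h, α.unit g h * f (g * h) = α'.unit g h * (f g * f h) := by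
  have : α.cls = α'.cls ↔ (α - α').cls = 0 := by
    rw [← sub_eq_zero]
    exact iff_of_eq (congrArg (· = 0) (map_sub (groupCohomology.H2π (unitsRep R G)).hom α α').symm)
  rw [this, cls_eq_zero_iff]
  refine exists_congr fun f => forall₂_congr fun g h => ?_
  have h2 : α.unit g h = (α - α').unit g h * α'.unit g h := by
    rw [← unit_add]
    exact congrArg (unit · g h) (sub_add_cancel α α').symm
  rw [h2, mul_right_comm, mul_comm (α'.unit g h), mul_left_inj]

/-- The class of the pullback, as a homomorphism on cocycles. -/
def inflation (π : G →* A) : TwoCocycle R A →+ SecondCohomology R G :=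
  AddMonoidHom.mk' (fun α => (pull π α).cls) fun α α' => by rw [map_add, cls_add]

theorem inflation_apply (π : G →* A) (α : TwoCocycle R A) :
    inflation π α = (pull π α).cls := rfl

end TwoCocycle

/-! ### Homomorphisms from twisted group algebras -/

namespace TwistedGroupAlgebra

variable {R G : Type} [CommRing R] [Group G] (α : TwoCocycle R G)

/-- A map `u` with `u(g) u(h) = α(g, h) u(gh)` and `u(1) = α(1, 1)` extends to an
algebra homomorphism on the twisted group algebra. -/
def lift {B : Type} [Ring B] [Algebra R B] (u : G → B)
    (h_one : u 1 = (α.unit 1 1 : R) • (1 : B))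
    (h_mul : ∀ g h, u g * u h = (α.unit g h : R) • u (g * h)) : TwistedGroupAlgebra α →ₐ[R] B :=
  AlgHom.ofLinearMap ((basis α).constr R u)
    (by rw [one_def, map_smul, ← basis_apply, Module.Basis.constr_basis, h_one, smul_smul,
      Units.inv_mul, one_smul])
    (fun x y => by
      have : (LinearMap.mul R (TwistedGroupAlgebra α)).compr₂ ((basis α).constr R u) =
          (LinearMap.mul R B).compl₁₂ ((basis α).constr R u) ((basis α).constr R u) := by
        refine (basis α).ext fun g => (basis α).ext fun h => ?_
        simp only [LinearMap.compr₂_apply, LinearMap.compl₁₂_apply, LinearMap.mul_apply',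
          Module.Basis.constr_basis, h_mul]
        rw [basis_apply, basis_apply, basisElt_mul_basisElt, map_smul, ← basis_apply,
          Module.Basis.constr_basis]
      exact LinearMap.congr_fun₂ this x y)

@[simp]
theorem lift_basisElt {B : Type} [Ring B] [Algebra R B] (u : G → B) (h_one h_mul) (g : G) :
    lift α u h_one h_mul (basisElt α g) = u g :=
  (basis α).constr_basis R u g

theorem basisElt_one : basisElt α 1 = (α.unit 1 1 : R) • (1 : TwistedGroupAlgebra α) := by
  rw [one_def, smul_smul, Units.mul_inv, one_smul]

theorem algHom_ext {B : Type} [Ring B] [Algebra R B] {φ ψ : TwistedGroupAlgebra α →ₐ[R] B}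
    (h : ∀ g, φ (basisElt α g) = ψ (basisElt α g)) : φ = ψ :=
  AlgHom.toLinearMap_injective ((basis α).ext h)

theorem linearMap_ext {B : Type} [AddCommGroup B] [Module R B]
    {φ ψ : TwistedGroupAlgebra α →ₗ[R] B}
    (h : ∀ g, φ (basisElt α g) = ψ (basisElt α g)) : φ = ψ :=
  (basis α).ext h

variable {α}

/-- The map `ḡ ↦ f(g) ḡ` between the twisted group algebras of cohomologous cocycles. -/
def homOfCoboundary {α' : TwoCocycle R G} (f : G → Rˣ)
    (hf : ∀ g h, α.unit g h * f (g * h) = α'.unit g h * (f g * f h)) :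
    TwistedGroupAlgebra α →ₐ[R] TwistedGroupAlgebra α' :=
  lift α (fun g => (f g : R) • basisElt α' g)
    (by
      have := hf 1 1
      rw [mul_one, ← mul_assoc, mul_left_inj] at this
      rw [basisElt_one, smul_smul, this, Units.val_mul, mul_comm])
    (fun g h => by
      have := congrArg Units.val (hf g h)
      push_cast at this
      rw [smul_mul_smul_comm, basisElt_mul_basisElt, smul_smul, smul_smul, this, mul_comm])

theorem nonempty_algEquiv_of_cls_eq {α α' : TwoCocycle R G} (h : α.cls = α'.cls) :
    Nonempty (TwistedGroupAlgebra α ≃ₐ[R] TwistedGroupAlgebra α') := by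
  obtain ⟨f, hf⟩ := TwoCocycle.cls_eq_iff.1 h
  have hf' (g h : G) :
      α'.unit g h * (f (g * h))⁻¹ = α.unit g h * ((f g)⁻¹ * (f h)⁻¹) := by
    rw [mul_inv_eq_iff_eq_mul, mul_right_comm, hf g h, mul_assoc, ← mul_inv, mul_inv_cancel,
      mul_one]
  refine ⟨AlgEquiv.ofAlgHom (homOfCoboundary f hf)
    (homOfCoboundary (fun g => (f g)⁻¹) hf') ?_ ?_⟩ <;>
  · refine algHom_ext _ fun g => ?_
    simp [homOfCoboundary, smul_smul]

end TwistedGroupAlgebra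

/-! ### Central covers with cyclic kernel -/

/-- `G` is a central extension of `A` by a cyclic group of order dividing `n` with generator `gen`,
the cocycle `μ` of `A` becomes trivial on `G` by means of a function with value `ζ` at `gen`, and
every cocycle of `G` is symmetric at `gen`. -/
structure CyclicCover {A : Type} [Group A] (G : Type) [Group G] (n : ℕ) (ζ : ℂˣ)
    (μ : TwoCocycle ℂ A) where
  /-- The projection. -/
  proj : G →* A
  proj_surjective : Function.Surjective proj
  /-- The generator of the kernel. -/
  gen : G
  gen_comm : ∀ g, Commute gen g
  gen_pow : gen ^ n = 1
  proj_gen : proj gen = 1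
  mem_zpowers : ∀ g, proj g = 1 → g ∈ Subgroup.zpowers gen
  /-- The function that trivializes the pullback of `μ`. -/
  scale : G → ℂˣ
  scale_mul : ∀ g h, scale (g * h) = scale g * scale h * μ.unit (proj g) (proj h)
  scale_gen : scale gen = ζ
  unit_one : μ.unit 1 1 = 1
  unit_gen : ∀ (α : TwoCocycle ℂ G) (g : G), α.unit gen g = α.unit g gen

/-- Orthogonality of the characters of `ℤ/n`; it makes `toPi` and `ofPi` mutually inverse. -/
theorem IsPrimitiveRoot.sum_pow_eq_ite {n : ℕ} [NeZero n] {ζ : ℂˣ} (hζ : IsPrimitiveRoot ζ n)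
    (i j : Fin n) :
    ∑ k : Fin n, (((ζ ^ (i : ℕ) * (ζ ^ (j : ℕ))⁻¹) ^ (k : ℕ) : ℂˣ) : ℂ) =
      if i = j then (n : ℂ) else 0 := by
  simp only [Units.val_pow_eq_pow_val (_ * _)]
  rw [Fin.sum_univ_eq_sum_range (fun k => ((ζ ^ (i : ℕ) * (ζ ^ (j : ℕ))⁻¹ : ℂˣ) : ℂ) ^ k)]
  split_ifs with h
  · simp [h]
  · have hw : (ζ ^ (i : ℕ) * (ζ ^ (j : ℕ))⁻¹) ^ n = 1 := by
      rw [mul_pow, inv_pow, ← pow_mul, ← pow_mul, mul_comm (i : ℕ), mul_comm (j : ℕ), pow_mul,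
        pow_mul, hζ.pow_eq_one, one_pow, one_pow, inv_one, mul_one]
    rw [geom_sum_eq, ← Units.val_pow_eq_pow_val, hw, Units.val_one, sub_self, zero_div]
    rw [Ne, Units.val_eq_one, mul_inv_eq_one]
    exact fun h' => h (Fin.ext (hζ.pow_inj i.2 j.2 h'))

namespace CyclicCover

variable {A G : Type} [Group A] [Group G] {n : ℕ} {ζ : ℂˣ} {μ : TwoCocycle ℂ A}
  (E : CyclicCover G n ζ μ)

/-- A section of the projection. -/
def sec : A → G := Function.surjInv E.proj_surjective

@[simp]
theorem proj_sec (a : A) : E.proj (E.sec a) = a := Function.surjInv_eq E.proj_surjective a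

@[simp]
theorem proj_mul_gen_pow (g : G) (j : ℕ) : E.proj (g * E.gen ^ j) = E.proj g := by
  rw [map_mul, map_pow, E.proj_gen, one_pow, mul_one]

theorem scale_mul_gen_pow (g : G) (j : ℕ) : E.scale (g * E.gen ^ j) = E.scale g * ζ ^ j := by
  induction j with
  | zero => simp
  | succ j ih =>
    rw [pow_succ, ← mul_assoc, E.scale_mul, ih, E.scale_gen, E.proj_gen, μ.unit_one_right,
      E.unit_one, mul_one, pow_succ, mul_assoc]

theorem scale_one : E.scale 1 = 1 := by
  have := E.scale_mul 1 1
  rw [map_one, E.unit_one, mul_one, mul_one] at this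
  exact left_eq_mul.1 this

theorem exists_fin_eq [NeZero n] {g h : G} (hgh : E.proj g = E.proj h) :
    ∃ j : Fin n, g = h * E.gen ^ (j : ℕ) := by
  obtain ⟨k, hk⟩ := E.mem_zpowers (h⁻¹ * g) (by rw [map_mul, map_inv, hgh, inv_mul_cancel])
  have hfin : IsOfFinOrder E.gen :=
    isOfFinOrder_iff_pow_eq_one.2 ⟨n, NeZero.pos n, E.gen_pow⟩
  obtain ⟨i, hi⟩ := hfin.mem_powers_iff_mem_zpowers.2 ⟨k, rfl⟩
  refine ⟨⟨i % n, Nat.mod_lt _ (NeZero.pos n)⟩, ?_⟩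
  rw [← inv_mul_eq_iff_eq_mul, ← hk, ← pow_eq_pow_mod _ E.gen_pow]
  exact hi.symm

/-- The values `ζ ^ j` of `scale` separate the powers of `gen`, so `gen` has order exactly `n`
without any normal form for `G`. -/
theorem gen_pow_eq_iff (hζ : IsPrimitiveRoot ζ n) {i j : ℕ} :
    E.gen ^ i = E.gen ^ j ↔ i ≡ j [MOD n] := by
  refine ⟨fun h => ?_, fun h => pow_eq_pow_of_modEq h E.gen_pow⟩
  have h2 : ζ ^ i = ζ ^ j := by
    simpa [E.scale_one, h] using
      (E.scale_mul_gen_pow 1 i).symm.trans ((congrArg _ (by rw [h])).trans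
        (E.scale_mul_gen_pow 1 j))
  rw [hζ.eq_orderOf]
  exact pow_eq_pow_iff_modEq.1 h2

/-! ### The kernel of inflation -/

/-- A trivialization of the inflated cocycle restricts to a character of the kernel, up to a
constant. A power of `scale` cancels this character, and the product descends to `A`. -/
theorem inflation_eq_zero_iff [NeZero n] (hζ : IsPrimitiveRoot ζ n) (l : TwoCocycle ℂ A) :
    TwoCocycle.inflation E.proj l = 0 ↔ ∃ k : ℕ, l.cls = (k • μ).cls := by
  simp only [TwoCocycle.inflation_apply, TwoCocycle.cls_eq_zero_iff, TwoCocycle.cls_eq_iff,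
    TwoCocycle.unit_pull, TwoCocycle.unit_nsmul]
  constructor
  · rintro ⟨f, hf⟩
    have h1 : f 1 = l.unit 1 1 := by
      have := hf 1 1
      rw [map_one, mul_one, mul_left_inj] at this
      exact this.symm
    -- Since `l` need not be normalized, `f` is a character on the kernel only after division by `f
    -- 1`; `t` is the value of that character at `gen`.
    obtain ⟨t, ht⟩ : ∃ t, f E.gen = f 1 * t := ⟨_, (mul_inv_cancel_left _ _).symm⟩
    have hstep (g : G) : f (g * E.gen) = f g * t := by
      have := hf g E.gen
      rw [E.proj_gen, l.unit_one_right, ← h1] at this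
      rw [ht, mul_left_comm, mul_right_inj] at this
      exact this
    have hpow (g : G) (j : ℕ) : f (g * E.gen ^ j) = f g * t ^ j := by
      induction j with
      | zero => simp
      | succ j ih => rw [pow_succ, ← mul_assoc, hstep, ih, pow_succ, mul_assoc]
    have htn : t ^ n = 1 := by
      have := hpow 1 n
      rw [E.gen_pow, mul_one] at this
      exact left_eq_mul.1 this
    -- The inverse of `t` is taken so that `scale ^ k` cancels the character.
    obtain ⟨k, -, hk⟩ := (IsPrimitiveRoot.coe_units_iff.2 hζ).eq_pow_of_pow_eq_one
      (ξ := ((t⁻¹ : ℂˣ) : ℂ)) (by rw [← Units.val_pow_eq_pow_val, inv_pow, htn]; simp)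
    replace hk : ζ ^ k = t⁻¹ := Units.ext (by rw [Units.val_pow_eq_pow_val, hk])
    have hinv {g h : G} (hgh : E.proj g = E.proj h) :
        f g * E.scale g ^ k = f h * E.scale h ^ k := by
      obtain ⟨j, rfl⟩ := E.exists_fin_eq hgh
      rw [hpow, E.scale_mul_gen_pow, mul_pow, ← pow_mul, mul_comm (j : ℕ), pow_mul, hk, inv_pow,
        mul_mul_mul_comm, mul_inv_cancel, mul_one]
    refine ⟨k, fun a => f (E.sec a) * E.scale (E.sec a) ^ k, fun a b => ?_⟩
    beta_reduce
    rw [hinv (g := E.sec (a * b)) (h := E.sec a * E.sec b) (by simp), ← mul_assoc]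
    have := hf (E.sec a) (E.sec b)
    rw [proj_sec, proj_sec] at this
    rw [this, E.scale_mul, proj_sec, proj_sec, mul_pow, mul_pow]
    refine Units.ext ?_
    push_cast
    ring
  · rintro ⟨k, c, hc⟩
    refine ⟨fun g => c (E.proj g) * (E.scale g)⁻¹ ^ k, fun g h => ?_⟩
    beta_reduce
    rw [map_mul, ← mul_assoc, hc, E.scale_mul, mul_inv, mul_inv, mul_pow, mul_pow,
      inv_pow (μ.unit _ _)]
    rw [mul_comm (μ.unit _ _ ^ k), mul_assoc, mul_comm (μ.unit _ _ ^ k), inv_mul_cancel_right,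
      mul_mul_mul_comm]

/-! ### Decomposition of the twisted group algebra -/

section Decomposition

variable (l : TwoCocycle ℂ A)

/-- The map `ḡ ↦ (f(g)^k \overline{π(g)})_k`, with `f` the scaling function of the cover. -/
def toPi : TwistedGroupAlgebra (TwoCocycle.pull E.proj l) →ₐ[ℂ]
    ∀ k : Fin n, TwistedGroupAlgebra (l + (k : ℕ) • μ) :=
  AlgHom.pi fun k => TwistedGroupAlgebra.lift _
    (fun g => ((E.scale g ^ (k : ℕ) : ℂˣ) : ℂ) • TwistedGroupAlgebra.basisElt _ (E.proj g))
    (by simp [E.scale_one, TwistedGroupAlgebra.basisElt_one, E.unit_one])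
    (fun g h => by
      rw [smul_mul_smul_comm, TwistedGroupAlgebra.basisElt_mul_basisElt, smul_smul, smul_smul,
        map_mul, E.scale_mul]
      congr 1
      simp only [TwoCocycle.unit_pull, TwoCocycle.unit_add, TwoCocycle.unit_nsmul, mul_pow,
        Units.val_mul]
      ring)

theorem toPi_basisElt (g : G) (k : Fin n) :
    E.toPi l (TwistedGroupAlgebra.basisElt _ g) k =
      ((E.scale g ^ (k : ℕ) : ℂˣ) : ℂ) • TwistedGroupAlgebra.basisElt _ (E.proj g) :=
  by
  simp [toPi]

/-- The inverse of `toPi`. -/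
def ofPi : (∀ k : Fin n, TwistedGroupAlgebra (l + (k : ℕ) • μ)) →ₗ[ℂ]
    TwistedGroupAlgebra (TwoCocycle.pull E.proj l) :=
  LinearMap.lsum ℂ (fun k : Fin n => TwistedGroupAlgebra (l + (k : ℕ) • μ)) ℂ fun k =>
    (TwistedGroupAlgebra.basis _).constr ℂ fun a => (n : ℂ)⁻¹ • ∑ j : Fin n,
      (((E.scale (E.sec a * E.gen ^ (j : ℕ)))⁻¹ ^ (k : ℕ) : ℂˣ) : ℂ) •
        TwistedGroupAlgebra.basisElt _ (E.sec a * E.gen ^ (j : ℕ))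

theorem ofPi_apply (x : ∀ k : Fin n, TwistedGroupAlgebra (l + (k : ℕ) • μ)) :
    E.ofPi l x = ∑ k : Fin n, (TwistedGroupAlgebra.basis _).constr ℂ (fun a => (n : ℂ)⁻¹ • ∑ j : Fin n,
      (((E.scale (E.sec a * E.gen ^ (j : ℕ)))⁻¹ ^ (k : ℕ) : ℂˣ) : ℂ) •
        TwistedGroupAlgebra.basisElt (TwoCocycle.pull E.proj l)
          (E.sec a * E.gen ^ (j : ℕ))) (x k) := by
  simp [ofPi, LinearMap.lsum_apply]

theorem ofPi_single (k : Fin n) (a : A) :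
    E.ofPi l (Pi.single k (TwistedGroupAlgebra.basisElt _ a)) = (n : ℂ)⁻¹ • ∑ j : Fin n,
      (((E.scale (E.sec a * E.gen ^ (j : ℕ)))⁻¹ ^ (k : ℕ) : ℂˣ) : ℂ) •
        TwistedGroupAlgebra.basisElt _ (E.sec a * E.gen ^ (j : ℕ)) := by
  rw [ofPi, LinearMap.lsum_piSingle, ← TwistedGroupAlgebra.basis_apply,
    Module.Basis.constr_basis]

/-- Fourier inversion on each coset of the kernel. -/
theorem ofPi_toPi [NeZero n] (hζ : IsPrimitiveRoot ζ n) (x : TwistedGroupAlgebra (TwoCocycle.pull E.proj l)) :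
    E.ofPi l (E.toPi l x) = x := by
  have hn : (n : ℂ) ≠ 0 := NeZero.ne _
  suffices h : E.ofPi l ∘ₗ (E.toPi l).toLinearMap = LinearMap.id from LinearMap.congr_fun h x
  refine TwistedGroupAlgebra.linearMap_ext _ fun g => ?_
  -- Only the summand `j = i`, the position of `g` in its coset, survives the sum over `k`.
  obtain ⟨i, hi⟩ := E.exists_fin_eq (g := g) (h := E.sec (E.proj g)) (by simp)
  have hw (j : Fin n) : ∑ k : Fin n, ((E.scale g ^ (k : ℕ) : ℂˣ) : ℂ) *
      (((E.scale (E.sec (E.proj g) * E.gen ^ (j : ℕ)))⁻¹ ^ (k : ℕ) : ℂˣ) : ℂ) =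
      if j = i then (n : ℂ) else 0 := by
    have h1 : E.scale g * (E.scale (E.sec (E.proj g) * E.gen ^ (j : ℕ)))⁻¹ =
        ζ ^ (i : ℕ) * (ζ ^ (j : ℕ))⁻¹ := by
      nth_rewrite 1 [hi]
      rw [E.scale_mul_gen_pow, E.scale_mul_gen_pow, mul_inv, mul_mul_mul_comm, mul_inv_cancel,
        one_mul]
    simp only [← Units.val_mul, ← mul_pow, h1]
    rw [hζ.sum_pow_eq_ite]
    simp only [eq_comm]
  rw [LinearMap.comp_apply, AlgHom.toLinearMap_apply, ofPi_apply]
  simp only [toPi_basisElt, map_smul]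
  simp only [← TwistedGroupAlgebra.basis_apply, Module.Basis.constr_basis, Finset.smul_sum, smul_smul]
  rw [Finset.sum_comm]
  have (j k : Fin n) : ((E.scale g ^ (k : ℕ) : ℂˣ) : ℂ) * ((n : ℂ)⁻¹ *
      (((E.scale (E.sec (E.proj g) * E.gen ^ (j : ℕ)))⁻¹ ^ (k : ℕ) : ℂˣ) : ℂ)) =
      (n : ℂ)⁻¹ * (((E.scale g ^ (k : ℕ) : ℂˣ) : ℂ) *
      (((E.scale (E.sec (E.proj g) * E.gen ^ (j : ℕ)))⁻¹ ^ (k : ℕ) : ℂˣ) : ℂ)) := by ring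
  simp only [this, ← Finset.sum_smul, ← Finset.mul_sum, hw]
  simp only [mul_ite, mul_zero, ite_smul, zero_smul, inv_mul_cancel₀ hn, one_smul,
    Finset.sum_ite_eq', Finset.mem_univ, if_true, ← hi, LinearMap.id_apply]

theorem toPi_ofPi [NeZero n] (hζ : IsPrimitiveRoot ζ n)
    (x : ∀ k : Fin n, TwistedGroupAlgebra (l + (k : ℕ) • μ)) :
    E.toPi l (E.ofPi l x) = x := by
  have hn : (n : ℂ) ≠ 0 := NeZero.ne _
  suffices h : (E.toPi l).toLinearMap ∘ₗ E.ofPi l = LinearMap.id from LinearMap.congr_fun h x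
  refine LinearMap.pi_ext' fun k => TwistedGroupAlgebra.linearMap_ext _ fun a => ?_
  simp only [LinearMap.comp_apply, LinearMap.coe_single, AlgHom.toLinearMap_apply, ofPi_single,
    LinearMap.id_apply]
  funext m
  have hw : ∑ j : Fin n, (((E.scale (E.sec a * E.gen ^ (j : ℕ)))⁻¹ ^ (k : ℕ) : ℂˣ) : ℂ) *
      ((E.scale (E.sec a * E.gen ^ (j : ℕ)) ^ (m : ℕ) : ℂˣ) : ℂ) =
      if m = k then (n : ℂ) else 0 := by
    -- Up to a factor independent of `j`, the summand is the `j`-th power of `ζ ^ m * (ζ ^ k)⁻¹`.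
    have h1 (j : ℕ) : (E.scale (E.sec a * E.gen ^ j))⁻¹ ^ (k : ℕ) *
        E.scale (E.sec a * E.gen ^ j) ^ (m : ℕ) =
        (E.scale (E.sec a) ^ (m : ℕ) * (E.scale (E.sec a) ^ (k : ℕ))⁻¹) *
          (ζ ^ (m : ℕ) * (ζ ^ (k : ℕ))⁻¹) ^ j := by
      rw [E.scale_mul_gen_pow]
      refine Units.ext ?_
      push_cast
      ring
    simp only [← Units.val_mul, h1]
    simp only [Units.val_mul _ ((_ * _) ^ _), ← Finset.mul_sum]
    rw [hζ.sum_pow_eq_ite]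
    split_ifs with h
    · subst h
      simp
    · rw [mul_zero]
  simp only [map_smul, map_sum, Pi.smul_apply, Finset.sum_apply, toPi_basisElt, smul_smul,
    proj_mul_gen_pow, proj_sec, ← Finset.sum_smul, hw]
  rcases eq_or_ne m k with rfl | hmk
  · simp [inv_mul_cancel₀ hn]
  · simp [hmk]

/-- The twisted group algebra of an inflated cocycle is a product of twisted group algebras of
the quotient. -/
def algEquivPi [NeZero n] (hζ : IsPrimitiveRoot ζ n) : TwistedGroupAlgebra (TwoCocycle.pull E.proj l) ≃ₐ[ℂ]
    ∀ k : Fin n, TwistedGroupAlgebra (l + (k : ℕ) • μ) :=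
  AlgEquiv.ofBijective (E.toPi l)
    ⟨Function.LeftInverse.injective (E.ofPi_toPi l hζ),
      Function.RightInverse.surjective (E.toPi_ofPi l hζ)⟩

end Decomposition

end CyclicCover

/-! ### Basis elements and scalars as units -/

namespace TwistedGroupAlgebra

variable {R G : Type} [CommRing R] [Group G] (α : TwoCocycle R G)

theorem _root_.TwoCocycle.unit_inv_self (α : TwoCocycle R G) (g : G) :
    α.unit g⁻¹ g = α.unit g g⁻¹ := by
  have := α.unit_mul_unit g g⁻¹ g
  rw [mul_inv_cancel, inv_mul_cancel, α.unit_one_left, α.unit_one_right g, mul_left_inj] at this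
  exact this.symm

/-- The basis element `ḡ` as a unit. -/
def unitElt (g : G) : (TwistedGroupAlgebra α)ˣ where
  val := basisElt α g
  inv := (((α.unit g g⁻¹)⁻¹ * (α.unit 1 1)⁻¹ : Rˣ) : R) • basisElt α g⁻¹
  val_inv := by
    rw [mul_smul_comm, basisElt_mul_basisElt, mul_inv_cancel, basisElt_one, smul_smul, smul_smul,
      ← Units.val_mul, ← Units.val_mul, ← mul_inv, mul_assoc, inv_mul_cancel, Units.val_one, one_smul]
  inv_val := by
    rw [smul_mul_assoc, basisElt_mul_basisElt, inv_mul_cancel, basisElt_one, smul_smul, smul_smul,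
      ← Units.val_mul, ← Units.val_mul, α.unit_inv_self, ← mul_inv, mul_assoc, inv_mul_cancel,
      Units.val_one, one_smul]

/-- The scalars as units. -/
def scalarUnit : Rˣ →* (TwistedGroupAlgebra α)ˣ :=
  Units.map (algebraMap R (TwistedGroupAlgebra α)).toMonoidHom

theorem scalarUnit_commute (c : Rˣ) (x : (TwistedGroupAlgebra α)ˣ) :
    Commute (scalarUnit α c) x :=
  Units.ext (Algebra.commutes (c : R) (x : TwistedGroupAlgebra α))

theorem scalarUnit_injective : Function.Injective (scalarUnit α) := by
  intro c c' h
  have h1 : algebraMap R (TwistedGroupAlgebra α) c = algebraMap R (TwistedGroupAlgebra α) c' :=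
    congrArg Units.val h
  rw [Algebra.algebraMap_eq_smul_one, Algebra.algebraMap_eq_smul_one, one_def, smul_smul,
    smul_smul] at h1
  have h3 := congrArg (fun x => (basis α).repr x 1) h1
  simp only [← basis_apply, map_smul, Module.Basis.repr_self, Finsupp.smul_apply,
    Finsupp.single_eq_same, smul_eq_mul, mul_one] at h3
  exact Units.ext ((Units.mul_left_inj (α.unit 1 1)⁻¹).1 h3)

theorem unitElt_mul (g h : G) :
    unitElt α g * unitElt α h = scalarUnit α (α.unit g h) * unitElt α (g * h) :=
  Units.ext ((basisElt_mul_basisElt α g h).trans (Algebra.smul_def _ _))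

theorem scalarUnit_mul_unitElt_inj {c c' : Rˣ} {g : G} :
    scalarUnit α c * unitElt α g = scalarUnit α c' * unitElt α g ↔ c = c' := by
  rw [mul_left_inj, (scalarUnit_injective α).eq_iff]

theorem unitElt_one : unitElt α 1 = scalarUnit α (α.unit 1 1) :=
  Units.ext ((basisElt_one α).trans (Algebra.algebraMap_eq_smul_one _).symm)

theorem exists_unitElt_pow (g : G) (k : ℕ) :
    ∃ c, unitElt α g ^ k = scalarUnit α c * unitElt α (g ^ k) := by
  induction k with
  | zero => exact ⟨(α.unit 1 1)⁻¹, by rw [pow_zero, pow_zero, unitElt_one, ← map_mul]; simp⟩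
  | succ k ih =>
    obtain ⟨c, hc⟩ := ih
    exact ⟨c * α.unit (g ^ k) g, by
      rw [pow_succ, hc, mul_assoc, unitElt_mul, ← mul_assoc, ← map_mul, pow_succ]⟩

end TwistedGroupAlgebra

theorem Complex.exists_units_pow_eq (u : ℂˣ) {k : ℕ} (hk : k ≠ 0) : ∃ c : ℂˣ, c ^ k = u := by
  obtain ⟨z, hz⟩ := IsAlgClosed.exists_pow_nat_eq (u : ℂ) (Nat.pos_of_ne_zero hk)
  have hz0 : z ≠ 0 := by
    rintro rfl
    rw [zero_pow hk] at hz
    exact u.ne_zero hz.symm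
  exact ⟨Units.mk0 z hz0, Units.ext (by simpa using hz)⟩

/-! ### Surjectivity of inflation and the equivalence of covers -/

namespace CyclicCover

open TwistedGroupAlgebra

variable {A G H : Type} [Group A] [Group G] [Group H] {n : ℕ} {ζ : ℂˣ} {μ : TwoCocycle ℂ A}

theorem exists_gen_lift (E : CyclicCover G n ζ μ) [NeZero n] (α : TwoCocycle ℂ G) :
    ∃ (c : ℂˣ), (scalarUnit α c * unitElt α E.gen) ^ n = 1 := by
  obtain ⟨c, hc⟩ := exists_unitElt_pow α E.gen n
  rw [E.gen_pow, unitElt_one, ← map_mul] at hc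
  set d := (c * α.unit 1 1)⁻¹ with hd
  obtain ⟨z, hz⟩ := Complex.exists_units_pow_eq d (NeZero.ne n)
  refine ⟨z, ?_⟩
  rw [(scalarUnit_commute α _ _).mul_pow, ← map_pow, hz, hc, ← map_mul, hd, inv_mul_cancel,
    map_one]

/-- The lift `B` of `gen`, scaled so that `B ^ n = 1`, commutes with all basis elements. Rescaling
the basis so that multiplication by `gen` becomes multiplication by `B` yields a cohomologous
cocycle that is constant on cosets of the kernel. -/
theorem inflation_surjective (E : CyclicCover G n ζ μ) [NeZero n] (hζ : IsPrimitiveRoot ζ n) :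
    Function.Surjective (TwoCocycle.inflation (R := ℂ) E.proj) := by
  intro x
  obtain ⟨α, rfl⟩ := TwoCocycle.cls_surjective (R := ℂ) (G := G) x
  obtain ⟨c, hB⟩ := E.exists_gen_lift α
  set B := scalarUnit α c * unitElt α E.gen with hBdef
  have hBu (g : G) : Commute B (unitElt α g) := by
    refine (scalarUnit_commute α c _).mul_left ?_
    rw [Commute, SemiconjBy, unitElt_mul, unitElt_mul, E.unit_gen, (E.gen_comm g).eq]
  have hBpow (k : ℕ) : ∃ d, B ^ k = scalarUnit α d * unitElt α (E.gen ^ k) := by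
    obtain ⟨d, hd⟩ := exists_unitElt_pow α E.gen k
    exact ⟨c ^ k * d, by
      rw [hBdef, (scalarUnit_commute α _ _).mul_pow, hd, map_mul, map_pow, mul_assoc]⟩
  have hBeq {i j : ℕ} (h : E.gen ^ i = E.gen ^ j) : B ^ i = B ^ j :=
    pow_eq_pow_of_modEq ((E.gen_pow_eq_iff hζ).1 h) hB
  choose i hi using fun g => E.exists_fin_eq (g := g) (h := E.sec (E.proj g)) (by simp)
  -- The rescaled basis: one lift is chosen on each coset and propagated by powers of `B`.
  let w (g : G) : (TwistedGroupAlgebra α)ˣ := unitElt α (E.sec (E.proj g)) * B ^ (i g : ℕ)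
  have hBw (g : G) (k : ℕ) : Commute (B ^ k) (w g) :=
    ((hBu _).mul_right (Commute.refl B |>.pow_right _)).pow_left k
  have hw_gen (g : G) (k : ℕ) : w (g * E.gen ^ k) = w g * B ^ k := by
    have h1 : E.gen ^ (i (g * E.gen ^ k) : ℕ) = E.gen ^ ((i g : ℕ) + k) := by
      have h2 := hi (g * E.gen ^ k)
      rw [E.proj_mul_gen_pow] at h2
      rw [pow_add, ← mul_right_inj (E.sec (E.proj g)), ← h2, ← mul_assoc, ← hi g]
    simp only [w]
    rw [E.proj_mul_gen_pow, hBeq h1, pow_add, mul_assoc]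
  have hw (g : G) : ∃ t, w g = scalarUnit α t * unitElt α g := by
    obtain ⟨d, hd⟩ := hBpow (i g)
    refine ⟨d * α.unit (E.sec (E.proj g)) (E.gen ^ (i g : ℕ)), ?_⟩
    simp only [w]
    rw [hd, ← mul_assoc, ← (scalarUnit_commute α d _).eq, mul_assoc, unitElt_mul, ← hi g,
      ← mul_assoc, ← map_mul]
  choose t ht using hw
  let τ (g h : G) : ℂˣ := α.unit g h * (t g * t h) * (t (g * h))⁻¹
  have hτ (g h : G) : w g * w h = scalarUnit α (τ g h) * w (g * h) := by
    rw [ht, ht, ht (g * h), (scalarUnit_commute α (t h) _).symm.mul_mul_mul_comm, unitElt_mul,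
      ← map_mul, ← mul_assoc, ← mul_assoc, ← map_mul, ← map_mul]
    simp only [τ, inv_mul_cancel_right]
    rw [mul_comm (t g * t h)]
  have hτ_inj {g h x : _} {c' : ℂˣ} (h1 : w g * w h = scalarUnit α c' * w x) (hx : g * h = x) :
      τ g h = c' := by
    subst hx
    rw [hτ, mul_left_inj] at h1
    exact scalarUnit_injective α h1
  -- Powers of `B` move freely past every `w g`, so they cancel from both sides of the equation that
  -- defines `τ`.
  have hτ_inv {g g' h h' : G} (hg : E.proj g = E.proj g') (hh : E.proj h = E.proj h') :
      τ g h = τ g' h' := by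
    obtain ⟨j, rfl⟩ := E.exists_fin_eq hg
    obtain ⟨k, rfl⟩ := E.exists_fin_eq hh
    refine hτ_inj (x := g' * h' * E.gen ^ ((j : ℕ) + k)) ?_ ?_
    · rw [hw_gen, hw_gen, hw_gen, (hBw _ _).mul_mul_mul_comm, hτ, pow_add, mul_assoc]
    · rw [((E.gen_comm h').pow_left _).mul_mul_mul_comm, pow_add]
  have hτ_cocycle (g h j : G) : τ g h * τ (g * h) j = τ h j * τ g (h * j) := by
    have h1 := congrArg Units.val (α.unit_mul_unit g h j)
    push_cast at h1
    refine Units.ext ?_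
    simp only [τ]
    push_cast
    rw [mul_assoc g h j]
    field_simp
    linear_combination h1
  -- The section is not multiplicative, but `τ` sees only projections, so its cocycle identity
  -- descends to `A`.
  refine ⟨TwoCocycle.ofUnit (fun a b => τ (E.sec a) (E.sec b)) fun a b e => ?_, ?_⟩
  · rw [hτ_inv (g := E.sec (a * b)) (g' := E.sec a * E.sec b) (by simp) rfl, hτ_cocycle,
      hτ_inv (h' := E.sec (b * e)) (h := E.sec b * E.sec e) rfl (by simp)]
  · rw [TwoCocycle.inflation_apply, TwoCocycle.cls_eq_iff]
    refine ⟨t, fun g h => ?_⟩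
    rw [TwoCocycle.unit_pull, TwoCocycle.unit_ofUnit,
      hτ_inv (g' := g) (h' := h) (by simp) (by simp)]
    exact inv_mul_cancel_right _ _

/-- Both second cohomology groups are the quotient of the cocycles of `A` by the same subgroup, and
corresponding classes are inflated from one `l`, whose product decomposition does not involve the
cover. -/
theorem twistedEquiv (E : CyclicCover G n ζ μ) (E' : CyclicCover H n ζ μ) [NeZero n]
    (hζ : IsPrimitiveRoot ζ n) : TwistedEquiv ℂ G H := by
  have hker : (TwoCocycle.inflation (R := ℂ) E.proj).ker = (TwoCocycle.inflation (R := ℂ) E'.proj).ker := by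
    ext l
    rw [AddMonoidHom.mem_ker, AddMonoidHom.mem_ker, E.inflation_eq_zero_iff hζ,
      E'.inflation_eq_zero_iff hζ]
  refine ⟨((QuotientAddGroup.quotientKerEquivOfSurjective _ (E.inflation_surjective hζ)).symm.trans
    (QuotientAddGroup.quotientAddEquivOfEq hker)).trans
    (QuotientAddGroup.quotientKerEquivOfSurjective _ (E'.inflation_surjective hζ)), ?_⟩
  intro α β h
  obtain ⟨l, hl⟩ := E.inflation_surjective hζ α.cls
  have h1 : (QuotientAddGroup.quotientKerEquivOfSurjective _
      (E.inflation_surjective hζ)).symm α.cls = QuotientAddGroup.mk l := by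
    rw [AddEquiv.symm_apply_eq]
    exact hl.symm
  rw [AddEquiv.trans_apply, AddEquiv.trans_apply, h1] at h
  have hl' : TwoCocycle.inflation E'.proj l = β.cls := h
  obtain ⟨e⟩ := nonempty_algEquiv_of_cls_eq (α := α) (hl.symm.trans (TwoCocycle.inflation_apply _ _))
  obtain ⟨e'⟩ := nonempty_algEquiv_of_cls_eq (α := β) (hl'.symm.trans (TwoCocycle.inflation_apply _ _))
  exact ⟨e.trans ((E.algEquivPi l hζ).trans ((E'.algEquivPi l hζ).symm.trans e'.symm))⟩

end CyclicCover

/-! ### The extension defined by a cocycle -/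

/-- The central extension of `G` by `Rˣ` defined by a cocycle. -/
@[ext]
structure TwoCocycle.Extension {R G : Type} [CommRing R] [Group G] (α : TwoCocycle R G) where
  /-- The scalar component. -/
  scalar : Rˣ
  /-- The component in the group. -/
  base : G

namespace TwoCocycle.Extension

variable {R G : Type} [CommRing R] [Group G] {α : TwoCocycle R G}

instance : Mul α.Extension :=
  ⟨fun x y => ⟨x.scalar * y.scalar * α.unit x.base y.base, x.base * y.base⟩⟩

instance : One α.Extension := ⟨⟨(α.unit 1 1)⁻¹, 1⟩⟩

instance : Inv α.Extension :=
  ⟨fun x => ⟨(x.scalar * α.unit x.base⁻¹ x.base * α.unit 1 1)⁻¹, x.base⁻¹⟩⟩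

@[simp] theorem scalar_mul (x y : α.Extension) :
    (x * y).scalar = x.scalar * y.scalar * α.unit x.base y.base := rfl
@[simp] theorem base_mul (x y : α.Extension) : (x * y).base = x.base * y.base := rfl
@[simp] theorem scalar_one : (1 : α.Extension).scalar = (α.unit 1 1)⁻¹ := rfl
@[simp] theorem base_one : (1 : α.Extension).base = 1 := rfl
@[simp] theorem scalar_inv (x : α.Extension) :
    x⁻¹.scalar = (x.scalar * α.unit x.base⁻¹ x.base * α.unit 1 1)⁻¹ := rfl
@[simp] theorem base_inv (x : α.Extension) : x⁻¹.base = x.base⁻¹ := rfl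

instance : Group α.Extension :=
  Group.ofLeftAxioms
    (fun x y z => by
      ext1
      · have h := α.unit_mul_unit x.base y.base z.base
        simp only [scalar_mul, base_mul]
        calc _ = x.scalar * y.scalar * z.scalar *
              (α.unit x.base y.base * α.unit (x.base * y.base) z.base) := by
              simp only [mul_assoc, mul_comm, mul_left_comm]
          _ = _ := by
              rw [h]
              simp only [mul_assoc]
      · exact mul_assoc _ _ _)
    (fun x => by
      ext1
      · simp only [scalar_mul, scalar_one, base_one, α.unit_one_left x.base]
        rw [mul_right_comm, inv_mul_cancel, one_mul]
      · exact one_mul _)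
    (fun x => by
      ext1
      · simp only [scalar_mul, scalar_inv, base_inv, scalar_one]
        rw [mul_assoc, mul_inv, mul_right_comm, inv_mul_cancel, one_mul]
      · exact inv_mul_cancel _)

/-- The projection to the group. -/
def toBase : α.Extension →* G where
  toFun := base
  map_one' := rfl
  map_mul' _ _ := rfl

@[simp] theorem toBase_apply (x : α.Extension) : toBase x = x.base := rfl

theorem pow_eq {x : α.Extension} (hx : ∀ k : ℕ, α.unit (x.base ^ k) x.base = 1) (k : ℕ) :
    x ^ k = ⟨x.scalar ^ k, x.base ^ k⟩ := by
  induction k with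
  | zero =>
    have h := hx 0
    rw [pow_zero, α.unit_one_left] at h
    ext1
    · simp [h]
    · simp
  | succ k ih =>
    rw [pow_succ, ih]
    ext1
    · simp only [scalar_mul]
      rw [hx, mul_one, pow_succ]
    · simp [pow_succ]

end TwoCocycle.Extension

/-! ### Lifts of commutators -/

namespace TwistedGroupAlgebra

variable {R G : Type} [CommRing R] [Group G] (α : TwoCocycle R G)

theorem unitElt_mul_eq_of_commute {g h : G} (hgh : Commute g h) :
    ∃ c, unitElt α g * unitElt α h = scalarUnit α c * (unitElt α h * unitElt α g) := by
  refine ⟨α.unit g h * (α.unit h g)⁻¹, ?_⟩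
  rw [unitElt_mul, unitElt_mul, hgh.eq, ← mul_assoc, ← map_mul, inv_mul_cancel_right]

/-- The lift of the commutator of `g` and `h` commutes with the lift of every element that
commutes with `g` and `h`. -/
theorem commute_unitElt_of_comm {g h b y : G} (hb : g * h = h * g * b) (hg : Commute y g)
    (hh : Commute y h) : Commute (unitElt α b) (unitElt α y) := by
  obtain ⟨r, hr⟩ := unitElt_mul_eq_of_commute α hg
  obtain ⟨s, hs⟩ := unitElt_mul_eq_of_commute α hh
  obtain ⟨c, hc⟩ : ∃ c, unitElt α g * unitElt α h =
      scalarUnit α c * (unitElt α h * unitElt α g * unitElt α b) := by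
    refine ⟨α.unit g h * (α.unit h g * α.unit (h * g) b)⁻¹, ?_⟩
    rw [unitElt_mul, unitElt_mul α h g, mul_assoc (scalarUnit α (α.unit h g)), unitElt_mul,
      ← mul_assoc, ← mul_assoc, ← map_mul, ← map_mul, hb,
      mul_assoc (α.unit g h * _), inv_mul_cancel_right]
  generalize unitElt α g = X at *
  generalize unitElt α h = Y at *
  generalize unitElt α b = B at *
  generalize unitElt α y = W at *
  have hz (c : Rˣ) (x : (TwistedGroupAlgebra α)ˣ) :
      x * scalarUnit α c = scalarUnit α c * x := ((scalarUnit_commute α c x).eq).symm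
  -- Conjugation by `W` scales `X * Y` and `Y * X` by the same factor, hence fixes their quotient,
  -- which is `B` up to a scalar.
  have h1 : W * (X * Y) = scalarUnit α (r * s) * (X * Y * W) := by
    rw [← mul_assoc, hr, mul_assoc, mul_assoc, hs, ← mul_assoc X, hz, map_mul]
    simp only [mul_assoc]
  have h2 : W * (Y * X) = scalarUnit α (r * s) * (Y * X * W) := by
    rw [← mul_assoc, hs, mul_assoc, mul_assoc, hr, ← mul_assoc Y, hz, mul_comm r s, map_mul]
    simp only [mul_assoc]
  rw [hc, ← mul_assoc, hz, mul_assoc, ← mul_assoc W, h2] at h1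
  have h3 : scalarUnit α c * scalarUnit α (r * s) * (Y * X) * (W * B) =
      scalarUnit α c * scalarUnit α (r * s) * (Y * X) * (B * W) := by
    simp only [mul_assoc] at h1 ⊢
    rw [h1]
    exact (scalarUnit_commute α (r * s) (scalarUnit α c)).left_comm _
  exact (mul_left_cancel h3).symm

/-- The elements whose lifts commute with a unit of the twisted group algebra. -/
def commutant (x : (TwistedGroupAlgebra α)ˣ) : Subgroup G where
  carrier := {y | Commute x (unitElt α y)}
  one_mem' := by
    change Commute x (unitElt α 1)
    rw [unitElt_one]
    exact (scalarUnit_commute α _ _).symm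
  mul_mem' {y w} hy hw := by
    have := (scalarUnit_commute α (α.unit y w)⁻¹ x).symm.mul_right (hy.mul_right hw)
    rwa [unitElt_mul, ← mul_assoc, ← map_mul, inv_mul_cancel, map_one, one_mul] at this
  inv_mem' {y} hy := by
    have h1 : unitElt α y⁻¹ =
        (unitElt α y)⁻¹ * (scalarUnit α (α.unit y y⁻¹) * scalarUnit α (α.unit 1 1)) := by
      rw [eq_inv_mul_iff_mul_eq, unitElt_mul, mul_inv_cancel, unitElt_one]
    change Commute x (unitElt α y⁻¹)
    rw [h1]
    exact hy.inv_right.mul_right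
      ((scalarUnit_commute α _ _).symm.mul_right (scalarUnit_commute α _ _).symm)

theorem unit_comm_of_commute {b g : G} (h : Commute b g)
    (hu : Commute (unitElt α b) (unitElt α g)) : α.unit b g = α.unit g b := by
  have := hu.eq
  rwa [unitElt_mul, unitElt_mul, h.eq, scalarUnit_mul_unitElt_inj] at this

end TwistedGroupAlgebra

/-! ### Relations in the four groups -/

namespace PhiFive

/-- The commutator relations of the four groups, for elements of an arbitrary group. -/
structure CommRelations {K : Type} [Group K] (f : Gen → K) : Prop where
  h12 : f .a1 * f .a2 = f .a2 * f .a1 * f .b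
  h34 : f .a3 * f .a4 = f .a4 * f .a3 * f .b
  h13 : Commute (f .a1) (f .a3)
  h14 : Commute (f .a1) (f .a4)
  h23 : Commute (f .a2) (f .a3)
  h24 : Commute (f .a2) (f .a4)
  h1b : Commute (f .a1) (f .b)
  h2b : Commute (f .a2) (f .b)
  h3b : Commute (f .a3) (f .b)
  h4b : Commute (f .a4) (f .b)

theorem commRelations_iff {K : Type} [Group K] {f : Gen → K} :
    CommRelations f ↔ ∀ r ∈ commRels, FreeGroup.lift f r = 1 := by
  have h1 (x y z : K) : x⁻¹ * y⁻¹ * x * y * z⁻¹ = 1 ↔ x * y = y * x * z := by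
    rw [mul_inv_eq_one, mul_assoc, mul_assoc, inv_mul_eq_iff_eq_mul, inv_mul_eq_iff_eq_mul,
      mul_assoc]
  have h2 (x y : K) : x⁻¹ * y⁻¹ * x * y = 1 ↔ Commute x y := by
    rw [mul_assoc, mul_assoc, inv_mul_eq_iff_eq_mul, inv_mul_eq_iff_eq_mul, mul_one]
    rfl
  simp only [commRels, comm, α₁, α₂, α₃, α₄, β, Set.mem_insert_iff, Set.mem_singleton_iff,
    forall_eq_or_imp, forall_eq, map_mul, map_inv, FreeGroup.lift_apply_of, h1, h2]
  exact ⟨fun ⟨a, b, c, d, e, f, g, h, i, j⟩ => ⟨a, b, c, d, e, f, g, h, i, j⟩,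
    fun ⟨a, b, c, d, e, f, g, h, i, j⟩ => ⟨a, b, c, d, e, f, g, h, i, j⟩⟩

/-- The power relations of the four groups, for elements of an arbitrary group. -/
def PowRelations {K : Type} [Group K] (p : ℕ) (f : Gen → K) : PhiFiveName → Prop
  | .phi3111 => f .a1 ^ p ^ 2 = f .b ∧ f .a2 ^ p = 1 ∧ f .a3 ^ p = 1 ∧ f .a4 ^ p = 1 ∧ f .b ^ p = 1
  | .phi2211a => f .a2 ^ p = f .b ∧ f .a1 ^ p ^ 2 = 1 ∧ f .a3 ^ p = 1 ∧ f .a4 ^ p = 1 ∧ f .b ^ p = 1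
  | .phi2211b => f .a3 ^ p = f .b ∧ f .a1 ^ p ^ 2 = 1 ∧ f .a2 ^ p = 1 ∧ f .a4 ^ p = 1 ∧ f .b ^ p = 1
  | .phi21111c => f .a1 ^ p ^ 2 = 1 ∧ f .a2 ^ p = 1 ∧ f .a3 ^ p = 1 ∧ f .a4 ^ p = 1 ∧ f .b ^ p = 1

theorem powRelations_iff {K : Type} [Group K] {p : ℕ} {f : Gen → K} {n : PhiFiveName} :
    PowRelations p f n ↔ ∀ r ∈ powRels p n, FreeGroup.lift f r = 1 := by
  cases n <;>
  simp only [PowRelations, powRels, α₁, α₂, α₃, α₄, β, Set.mem_insert_iff,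
    Set.mem_singleton_iff, forall_eq_or_imp, forall_eq, map_mul, map_inv, map_pow,
    FreeGroup.lift_apply_of, mul_inv_eq_one]

/-- The homomorphism defined by images of the generators that satisfy the relations. -/
def toGroup {K : Type} [Group K] {p : ℕ} {f : Gen → K} {n : PhiFiveName} (hc : CommRelations f)
    (hp : PowRelations p f n) : PhiFiveGroup p n →* K :=
  PresentedGroup.toGroup (f := f) fun r hr =>
    hr.elim (commRelations_iff.1 hc r) (powRelations_iff.1 hp r)

@[simp]
theorem toGroup_of {K : Type} [Group K] {p : ℕ} {f : Gen → K} {n : PhiFiveName}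
    (hc : CommRelations f) (hp : PowRelations p f n) (i : Gen) :
    toGroup hc hp (PresentedGroup.of i) = f i :=
  PresentedGroup.toGroup.of _

theorem lift_of_eq_one {rels : Set F} {r : F} (hr : r ∈ rels) :
    FreeGroup.lift (PresentedGroup.of (rels := rels)) r = 1 := by
  have : FreeGroup.lift (PresentedGroup.of (rels := rels)) = PresentedGroup.mk rels := by
    ext i
    simp [PresentedGroup.of]
  rw [this]
  exact PresentedGroup.one_of_mem hr

variable (p : ℕ) (n : PhiFiveName)

theorem commRelations_of :
    CommRelations (PresentedGroup.of : Gen → PhiFiveGroup p n) :=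
  commRelations_iff.2 fun _ hr => lift_of_eq_one (Or.inl hr)

theorem powRelations_of :
    PowRelations p (PresentedGroup.of : Gen → PhiFiveGroup p n) n :=
  powRelations_iff.2 fun _ hr => lift_of_eq_one (Or.inr hr)

theorem of_b_pow : (PresentedGroup.of Gen.b : PhiFiveGroup p n) ^ p = 1 := by
  have := powRelations_of p n
  cases n <;> exact this.2.2.2.2

theorem commute_of_b (g : PhiFiveGroup p n) : Commute (PresentedGroup.of Gen.b) g := by
  have h := commRelations_of p n
  refine (Subgroup.mem_centralizer_singleton_iff.1 (PresentedGroup.generated_by _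
    (Subgroup.centralizer {PresentedGroup.of Gen.b}) (fun i => ?_) g)).symm
  rw [Subgroup.mem_centralizer_singleton_iff]
  cases i
  exacts [h.h1b.eq, h.h2b.eq, h.h3b.eq, h.h4b.eq, rfl]

/-- For each of the four generators `αᵢ`, `β` is written as the commutator of the pair not
containing it; both members of that pair commute with it. -/
theorem unit_of_b_comm (α : TwoCocycle ℂ (PhiFiveGroup p n)) (g : PhiFiveGroup p n) :
    α.unit (PresentedGroup.of Gen.b) g = α.unit g (PresentedGroup.of Gen.b) := by
  have h := commRelations_of p n
  refine TwistedGroupAlgebra.unit_comm_of_commute α (commute_of_b p n g) ?_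
  refine PresentedGroup.generated_by _ (TwistedGroupAlgebra.commutant α
    (TwistedGroupAlgebra.unitElt α (PresentedGroup.of Gen.b))) (fun i => ?_) g
  cases i
  · exact TwistedGroupAlgebra.commute_unitElt_of_comm α h.h34 h.h13 h.h14
  · exact TwistedGroupAlgebra.commute_unitElt_of_comm α h.h34 h.h23 h.h24
  · exact TwistedGroupAlgebra.commute_unitElt_of_comm α h.h12 h.h13.symm h.h23.symm
  · exact TwistedGroupAlgebra.commute_unitElt_of_comm α h.h12 h.h14.symm h.h24.symm
  · exact Commute.refl _

/-! ### The common quotient -/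

/-- The common quotient of the four groups by `⟨β⟩`. -/
abbrev Quo : Type := PresentedGroup (commRels ∪ powRels p .phi21111c ∪ {β})

theorem commRelations_quo : CommRelations (PresentedGroup.of : Gen → Quo p) :=
  commRelations_iff.2 fun _ hr => lift_of_eq_one (Or.inl (Or.inl hr))

theorem quo_b : (PresentedGroup.of Gen.b : Quo p) = 1 := by
  have := lift_of_eq_one (rels := commRels ∪ powRels p .phi21111c ∪ {β}) (r := β) (Or.inr rfl)
  rwa [β, FreeGroup.lift_apply_of] at this

theorem powRelations_quo : PowRelations p (PresentedGroup.of : Gen → Quo p) n := by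
  obtain ⟨h1, h2, h3, h4, -⟩ : PowRelations p (PresentedGroup.of : Gen → Quo p) .phi21111c :=
    powRelations_iff.2 fun _ hr => lift_of_eq_one (Or.inl (Or.inr hr))
  have hb := quo_b p
  cases n <;> simp only [PowRelations, h1, h2, h3, h4, hb, one_pow, and_self]

/-- The projection to the common quotient. -/
def proj : PhiFiveGroup p n →* Quo p := toGroup (commRelations_quo p) (powRelations_quo p n)

@[simp]
theorem proj_of (i : Gen) : proj p n (PresentedGroup.of i) = PresentedGroup.of i :=
  toGroup_of _ _ i

theorem proj_surjective : Function.Surjective (proj p n) := by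
  intro x
  refine PresentedGroup.generated_by _ (proj p n).range (fun i => ?_) x
  exact ⟨_, proj_of p n i⟩

/-- Modulo `⟨β⟩` the group satisfies the relations of `Quo p`, which gives a map from `Quo p` back
to this quotient; composed with `proj` it is the quotient map. -/
theorem mem_zpowers_of_proj_eq_one {g : PhiFiveGroup p n} (hg : proj p n g = 1) :
    g ∈ Subgroup.zpowers (PresentedGroup.of Gen.b : PhiFiveGroup p n) := by
  set Z := Subgroup.zpowers (PresentedGroup.of Gen.b : PhiFiveGroup p n) with hZ
  have hnormal : Z.Normal := by
    have hle : Z ≤ Subgroup.center _ := by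
      rw [hZ, Subgroup.zpowers_le, Subgroup.mem_center_iff]
      exact fun g => (commute_of_b p n g).eq.symm
    exact ⟨fun x hx g => by
      rwa [Subgroup.mem_center_iff.1 (hle hx) g, mul_inv_cancel_right]⟩
  let f (i : Gen) : PhiFiveGroup p n ⧸ Z := QuotientGroup.mk' Z (PresentedGroup.of i)
  have hlift (r : F) : FreeGroup.lift f r =
      QuotientGroup.mk' Z (FreeGroup.lift PresentedGroup.of r) := by
    have : FreeGroup.lift f = (QuotientGroup.mk' Z).comp (FreeGroup.lift PresentedGroup.of) := by
      ext i
      simp [f]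
    rw [this, MonoidHom.comp_apply]
  have hb : f .b = 1 := (QuotientGroup.eq_one_iff _).2 (Subgroup.mem_zpowers _)
  have hpow : PowRelations p f .phi21111c := by
    have h : PowRelations p f n := powRelations_iff.2 fun r hr => by
      rw [hlift, powRelations_iff.1 (powRelations_of p n) r hr, map_one]
    cases n <;> simp only [PowRelations, hb] at h ⊢ <;> tauto
  have hrel (r : F) (hr : r ∈ commRels ∪ powRels p .phi21111c ∪ {β}) :
      FreeGroup.lift f r = 1 := by
    obtain (hr | hr) | rfl := hr
    · rw [hlift, commRelations_iff.1 (commRelations_of p n) r hr, map_one]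
    · exact powRelations_iff.1 hpow r hr
    · rw [β, FreeGroup.lift_apply_of, hb]
  have hcomp : (PresentedGroup.toGroup hrel).comp (proj p n) = QuotientGroup.mk' Z := by
    refine PresentedGroup.ext fun i => ?_
    rw [MonoidHom.comp_apply, proj_of, PresentedGroup.toGroup.of]
  rw [← QuotientGroup.eq_one_iff]
  have := DFunLike.congr_fun hcomp g
  rw [MonoidHom.comp_apply, hg, map_one] at this
  exact this.symm

/-! ### The Heisenberg cocycle -/

/-- The images of the generators in `(ℤ/p)⁴`. -/
def vec : Gen → Multiplicative (Fin 4 → ZMod p)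
  | .a1 => .ofAdd (Pi.single 0 1)
  | .a2 => .ofAdd (Pi.single 1 1)
  | .a3 => .ofAdd (Pi.single 2 1)
  | .a4 => .ofAdd (Pi.single 3 1)
  | .b => 1

theorem vec_pow {p : ℕ} (i : Gen) : vec p i ^ p = 1 := by
  refine Multiplicative.toAdd.injective (funext fun j => ?_)
  simp [toAdd_pow]

theorem vec_pow_sq {p : ℕ} (i : Gen) : vec p i ^ p ^ 2 = 1 := by
  rw [sq, pow_mul, vec_pow, one_pow]

theorem lift_vec_eq_one (r : F) (hr : r ∈ commRels ∪ powRels p .phi21111c ∪ {β}) :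
    FreeGroup.lift (vec p) r = 1 := by
  obtain (hr | hr) | rfl := hr
  · refine commRelations_iff.1 ?_ r hr
    constructor
    all_goals first | exact Commute.all _ _ | simp [vec, mul_comm]
  · refine powRelations_iff.1 ?_ r hr
    simp only [PowRelations, vec_pow, vec_pow_sq, and_self]
  · rw [β, FreeGroup.lift_apply_of, vec]

/-- The map from the common quotient to `(ℤ/p)⁴`. -/
def quoVec : Quo p →* Multiplicative (Fin 4 → ZMod p) :=
  PresentedGroup.toGroup (lift_vec_eq_one p)

@[simp]
theorem quoVec_of {p : ℕ} (i : Gen) : quoVec p (PresentedGroup.of i) = vec p i :=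
  PresentedGroup.toGroup.of _

variable {p} [NeZero p] {ζ : ℂˣ} (hζ : ζ ^ p = 1)

/-- The cocycle `(v, w) ↦ ζ ^ (v₀ w₁ + v₂ w₃)` on `(ℤ/p)⁴`. -/
def heisenbergCocycle : TwoCocycle ℂ (Multiplicative (Fin 4 → ZMod p)) :=
  TwoCocycle.ofUnit
    (fun v w => AddChar.zmodChar p hζ
      (v.toAdd 0 * w.toAdd 1 + v.toAdd 2 * w.toAdd 3))
    fun v w x => by
      rw [← AddChar.map_add_eq_mul, ← AddChar.map_add_eq_mul]
      congr 1
      simp only [toAdd_mul, Pi.add_apply]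
      ring

theorem unit_heisenbergCocycle (v w : Multiplicative (Fin 4 → ZMod p)) :
    (heisenbergCocycle hζ).unit v w = AddChar.zmodChar p hζ
      (v.toAdd 0 * w.toAdd 1 + v.toAdd 2 * w.toAdd 3) := rfl

/-- The exponent pairs only distinct coordinates, so it vanishes on multiples of one basis vector.
Powers of lifts are therefore computed componentwise. -/
theorem heisenbergCocycle_vec_pow (i : Gen) (k : ℕ) :
    (heisenbergCocycle hζ).unit (vec p i ^ k) (vec p i) = 1 := by
  rw [unit_heisenbergCocycle]
  cases i <;> simp [vec, toAdd_pow]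

theorem heisenbergCocycle_one_one : (heisenbergCocycle hζ).unit 1 1 = 1 := by
  simp [unit_heisenbergCocycle]

theorem zmodChar_one : AddChar.zmodChar p hζ 1 = ζ := by
  simpa using AddChar.zmodChar_apply' hζ 1

/-- The lifts of the generators to the Heisenberg extension, with scalars `c`. -/
def heisenbergGen (c : Gen → ℂˣ) (i : Gen) : (heisenbergCocycle hζ).Extension := ⟨c i, vec p i⟩

theorem heisenbergGen_pow (c : Gen → ℂˣ) (i : Gen) (k : ℕ) :
    heisenbergGen hζ c i ^ k = ⟨c i ^ k, vec p i ^ k⟩ :=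
  TwoCocycle.Extension.pow_eq (heisenbergCocycle_vec_pow hζ i) k

/-- Scalars cancel in commutators, so those of `α₁, …, α₄` stay free for the power relations. -/
theorem commRelations_heisenbergGen {c : Gen → ℂˣ} (hc : c .b = ζ) :
    CommRelations (heisenbergGen hζ c) := by
  constructor
  all_goals
    refine TwoCocycle.Extension.ext ?_ ?_ <;>
    simp [heisenbergGen, vec, unit_heisenbergCocycle, zmodChar_one, hc, mul_comm]

/-- A root of `ζ`, attached to the one generator whose power is to be `β`, realizes that relation;
all other generators except `β` get the scalar `1`. -/
theorem exists_powRelations_heisenbergGen :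
    ∃ c : Gen → ℂˣ, c .b = ζ ∧ PowRelations p (heisenbergGen hζ c) n := by
  have hp : p ≠ 0 := NeZero.ne p
  obtain ⟨r, hr⟩ := Complex.exists_units_pow_eq ζ hp
  obtain ⟨s, hs⟩ := Complex.exists_units_pow_eq ζ (pow_ne_zero 2 hp)
  have hone : (1 : (heisenbergCocycle hζ).Extension) = ⟨1, 1⟩ :=
    TwoCocycle.Extension.ext (by simp [heisenbergCocycle_one_one]) rfl
  cases n
  · refine ⟨fun | .a1 => s | .b => ζ | _ => 1, rfl, ?_⟩
    simp [PowRelations, heisenbergGen_pow, hone, vec_pow, vec_pow_sq, hζ, hs]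
    simp [heisenbergGen, vec]
  · refine ⟨fun | .a2 => r | .b => ζ | _ => 1, rfl, ?_⟩
    simp [PowRelations, heisenbergGen_pow, hone, vec_pow, vec_pow_sq, hζ, hr]
    simp [heisenbergGen, vec]
  · refine ⟨fun | .a3 => r | .b => ζ | _ => 1, rfl, ?_⟩
    simp [PowRelations, heisenbergGen_pow, hone, vec_pow, vec_pow_sq, hζ, hr]
    simp [heisenbergGen, vec]
  · refine ⟨fun | .b => ζ | _ => 1, rfl, ?_⟩
    simp [PowRelations, heisenbergGen_pow, hone, vec_pow, vec_pow_sq, hζ]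

/-- The map to the Heisenberg extension has the required projection to `(ℤ/p)⁴`, and its scalar
component is the function `scale`. -/
theorem nonempty_cyclicCover : Nonempty (CyclicCover (PhiFiveGroup p n) p ζ
    (TwoCocycle.pull (quoVec p) (heisenbergCocycle hζ))) := by
  obtain ⟨c, hcb, hc⟩ := exists_powRelations_heisenbergGen n hζ
  let ρ := toGroup (commRelations_heisenbergGen hζ hcb) hc
  have hρ (g : PhiFiveGroup p n) : (ρ g).base = quoVec p (proj p n g) := by
    have : TwoCocycle.Extension.toBase.comp ρ = (quoVec p).comp (proj p n) :=
      PresentedGroup.ext fun i => by simp [ρ, heisenbergGen]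
    exact DFunLike.congr_fun this g
  exact ⟨{
    proj := proj p n
    proj_surjective := proj_surjective p n
    gen := PresentedGroup.of Gen.b
    gen_comm := commute_of_b p n
    gen_pow := of_b_pow p n
    proj_gen := by rw [proj_of, quo_b]
    mem_zpowers := fun _ => mem_zpowers_of_proj_eq_one p n
    scale := fun g => (ρ g).scalar
    scale_mul := fun g h => by
      rw [map_mul, TwoCocycle.Extension.scalar_mul, hρ, hρ, TwoCocycle.unit_pull]
    scale_gen := by simp [ρ, heisenbergGen, hcb]
    unit_one := by rw [TwoCocycle.unit_pull, map_one, heisenbergCocycle_one_one]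
    unit_gen := unit_of_b_comm p n }⟩

end PhiFive

/-! ### Transport along isomorphisms and the conclusion -/

/-- Transport of a cover along an isomorphism. -/
def CyclicCover.congr {A G H : Type} [Group A] [Group G] [Group H] {n : ℕ} {ζ : ℂˣ}
    {μ : TwoCocycle ℂ A} (E : CyclicCover G n ζ μ) (e : H ≃* G) : CyclicCover H n ζ μ where
  proj := E.proj.comp e.toMonoidHom
  proj_surjective := E.proj_surjective.comp e.surjective
  gen := e.symm E.gen
  gen_comm g := by simpa using (E.gen_comm (e g)).map e.symm
  gen_pow := by rw [← map_pow, E.gen_pow, map_one]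
  proj_gen := by simpa using E.proj_gen
  mem_zpowers g hg := by
    obtain ⟨k, hk⟩ := E.mem_zpowers (e g) hg
    exact ⟨k, e.injective (by simpa using hk)⟩
  scale g := E.scale (e g)
  scale_mul g h := by
    rw [map_mul]
    exact E.scale_mul _ _
  scale_gen := by rw [MulEquiv.apply_symm_apply, E.scale_gen]
  unit_one := E.unit_one
  unit_gen α g := by
    simpa using E.unit_gen (TwoCocycle.pull e.symm.toMonoidHom α) (e g)

end

theorem theorem3p3 (p : ℕ) (hp : p.Prime) (hodd : Odd p) (m n : PhiFiveName)
    (G H : Type) [Group G] [Group H]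
    (hG : Nonempty (G ≃* PhiFiveGroup p m)) (hH : Nonempty (H ≃* PhiFiveGroup p n)) :
    TwistedEquiv ℂ G H := by
  obtain ⟨e⟩ := hG
  obtain ⟨e'⟩ := hH
  have : NeZero p := ⟨hp.ne_zero⟩
  have hprim := Complex.isPrimitiveRoot_exp p hp.ne_zero
  obtain ⟨ζ, hζ⟩ := hprim.isUnit hp.ne_zero
  have hζp : IsPrimitiveRoot ζ p := IsPrimitiveRoot.coe_units_iff.1 (by rwa [hζ])
  -- The same `ζ`, hence the same cocycle `μ` on `Quo p`, is used for both groups.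
  obtain ⟨E⟩ := PhiFive.nonempty_cyclicCover m hζp.pow_eq_one
  obtain ⟨E'⟩ := PhiFive.nonempty_cyclicCover n hζp.pow_eq_one
  exact (E.congr e).twistedEquiv (E'.congr e') hζp
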